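/- **Setting.** Let $\mathcal T$ be a family of finite rooted trees (objects with an underlying finite rooted tree, possibly carrying more structure such as an order of the children or a labelling) with finitely many members on $n$ vertices for each $n$. Write $|T|$ for the number of vertices of $T$, $r(T)$ for its root, and $d(u,v)$ for the number of edges in the path between $u$ and $v$. A leaf is a vertex without children (the root of a one-vertex tree is a leaf), and $w$ is a descendant of $v$ if $w$ lies in the subtree rooted at $v$ (so $v$ is a descendant of itself). The family is *graftable* if removing the subtree rooted at a marked vertex and putting a leaf in its place gives a bijection from the members of $\mathcal T$ with a marked vertex to the pairs consisting of a member of $\mathcal T$ with a marked leaf and a member of $\mathcal T$; the inverse bijection replaces the marked leaf by the second tree. Let $T(x)$, $V(x)$, $L(x)$ be the generating functions of trees, vertices and leaves: $$T(x)=\sum_{T\in\mathcal T}x^{|T|},\qquad V(x)=\sum_{T\in\mathcal T}|T|\,x^{|T|},\qquad L(x)=\sum_{T\in\mathcal T}\#\{\text{leaves of }T\}\,x^{|T|}.$$ For a family of labelled trees (the vertices of $T$ are labelled $0,\dots,|T|-1$), $x^{|T|}$ is replaced by $x^{|T|}/|T|!$ in all generating functions, and graftable means the following: removing the subtree at a marked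 vertex, putting in its place a leaf with a prescribed label $i$, and renumbering all other labels in an order-preserving way, is a bijection from the triples (tree, marked vertex, $i$) to the triples (tree with a marked leaf, tree, set of the labels that were used in the subtree). The admissible $i$ are the labels of the tree that remains, and the admissible label sets are the subsets of $\{0,\dots,n-1\}$ whose size is that of the second tree, where $n$ is the number of vertices of the tree obtained by grafting. **Corollary 2.3.** There are polynomials $P_0,P_1,P_2,\dots\in\mathbb Q[y]$, not depending on the family, with $P_0=1$ and $$P_k(y)=k!\,y^k-\frac{k!\,(k-1)}{2}\,y^{k-1}+Q_k(y)\qquad(k\ge 1),$$ where $Q_k=0$ for $k<2$ and $Q_k$ is a polynomial of degree $k-2$ for $k\ge 2$ (for $k=2$ a constant, possibly $0$), such that for every graftable family $\mathcal T$ and every $k\in\mathbb N=\{0,1,2,\dots\}$ $$\sum_{T\in\mathcal T}\ \sum_{v\in T}d(v,r(T))^k\,x^{|T|}=P_k\!\left(\frac{L(x)}{x}\right)\bigl(V(x)-T(x)\bigr),$$ and, with the same $P_k$: 1. paths between the root and the leaves: $$\sum_{T\in\mathcal T}\ \sum_{\substack{l\in T\\ l\text{ a leaf}}}d(l,r(T))^k\,x^{|T|}=P_k\!\left(\frac{L(x)}{x}\right)\bigl(L(x)-t_1x\bigr);$$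 2. paths between an arbitrary vertex and one of its descendants: $$\sum_{T\in\mathcal T}\ \sum_{\substack{v,w\in T\\ w\text{ a descendant of }v}}d(v,w)^k\,x^{|T|}=P_k\!\left(\frac{L(x)}{x}\right)\frac{L(x)}{x}\bigl(V(x)-T(x)\bigr);$$ 3. paths between an arbitrary vertex and one of its descendant leaves: $$\sum_{T\in\mathcal T}\ \sum_{\substack{v,l\in T\\ l\text{ a descendant of }v\\ l\text{ a leaf}}}d(v,l)^k\,x^{|T|}=P_k\!\left(\frac{L(x)}{x}\right)\frac{L(x)}{x}\bigl(L(x)-t_1x\bigr).$$ Here $t_1=[x^1]T(x)$ is the number of one-vertex trees in $\mathcal T$; for $k=0$ the convention $0^0=0$ is used, that is, paths of length $0$ are not counted; and for labelled families $x^{|T|}$ is replaced by $x^{|T|}/|T|!$ throughout. All identities are identities of formal power series. -/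

import Mathlib

noncomputable section

namespace PathLengths

/-- A finite rooted tree: a connected graph without cycles on a finite vertex set, together with
a designated vertex, the root. -/
structure FinRootedTree.{u} where
  V : Type u
  [fintypeV : Fintype V]
  graph : SimpleGraph V
  isTree : graph.IsTree
  root : V

attribute [instance] FinRootedTree.fintypeV

namespace FinRootedTree

/-- The number of vertices. -/
def size (t : FinRootedTree) : ℕ := Fintype.card t.V

/-- `t.dist u v` is the number of edges in the path between `u` and `v`. -/
def dist (t : FinRootedTree) (u v : t.V) : ℕ := t.graph.dist u v

/-- `c` is a child of `v` (and `v` the parent of `c`): they are neighbours and `v` is the one that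
is closer to the root. -/
def IsChild (t : FinRootedTree) (v c : t.V) : Prop :=
  t.graph.Adj v c ∧ t.dist t.root v < t.dist t.root c

/-- `w` is a descendant of `v`, i.e. a vertex of the subtree rooted at `v`. Every vertex is a
descendant of itself. -/
def IsDescendant (t : FinRootedTree) (v w : t.V) : Prop :=
  Relation.ReflTransGen t.IsChild v w

/-- A leaf is a vertex without children. The only vertex of a one-vertex tree is a leaf. -/
def IsLeaf (t : FinRootedTree) (v : t.V) : Prop := ∀ c, ¬ t.IsChild v c

/-- A realization of `t`, with the marked vertex `v`, as the tree that is obtained from `s` by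
replacing its leaf `l` by the tree `t'`: the subtree of `t` rooted at `v` is a copy of `t'`, and
replacing that subtree by a leaf (that is, deleting the descendants of `v` other than `v`) leaves a
copy of `s`, in which `v` has become the leaf `l`. -/
structure Graft (t : FinRootedTree) (v : t.V) (s : FinRootedTree) (l : s.V)
    (t' : FinRootedTree) where
  lower : t'.graph ≃g t.graph.induce {w | t.IsDescendant v w}
  lower_root : (lower t'.root : t.V) = v
  upper : s.graph ≃g t.graph.induce {w | w = v ∨ ¬ t.IsDescendant v w}
  upper_root : (upper s.root : t.V) = t.root
  upper_leaf : (upper l : t.V) = v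

end FinRootedTree

/-- A family of trees: a collection of objects, each of them with an underlying finite rooted tree
(an object may carry more structure, such as an order of the children or a labelling), with
finitely many objects on `n` vertices for every `n`. -/
structure TreeFamily.{u, v} where
  Obj : Type u
  tree : Obj → FinRootedTree.{v}
  finite_size : ∀ n : ℕ, {a : Obj | (tree a).size = n}.Finite

/-- Generating functions are ordinary, or (for labelled trees) exponential. -/
inductive Kind where
  | ordinary
  | exponential

/-- An object of size `n` contributes `x ^ n` to an ordinary generating function and `x ^ n / n!`
to an exponential one. -/
def Kind.weight : Kind → ℕ → ℚ
  | .ordinary, _ => 1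
  | .exponential, n => 1 / (n.factorial : ℚ)

/-- The `k`-th power of the length `d` of a path, with the convention `0 ^ 0 = 0`: paths of length
`0` count for nothing, also when `k = 0`. -/
def lengthPow (k d : ℕ) : ℚ := if d = 0 then 0 else (d : ℚ) ^ k

namespace TreeFamily

/-- An object of the family with a marked vertex. -/
abbrev Marked (F : TreeFamily) := Σ a : F.Obj, (F.tree a).V

/-- An object of the family with a marked leaf. -/
abbrev LeafMarked (F : TreeFamily) := Σ a : F.Obj, {l : (F.tree a).V // (F.tree a).IsLeaf l}

/-- The grafting bijection for a family without labels: removing the subtree at a marked vertex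
and putting a leaf in its place is a bijection from the objects with a marked vertex to the pairs
of an object with a marked leaf and an object. -/
def OrdinaryGraftable (F : TreeFamily) : Prop :=
  ∃ e : F.Marked ≃ F.LeafMarked × F.Obj, ∀ p : F.Marked,
    Nonempty ((F.tree p.1).Graft p.2 (F.tree (e p).1.1) (e p).1.2 (F.tree (e p).2))

/-- The grafting bijection for a family of labelled trees; the vertices of a tree on `n` vertices
are labelled by `0, …, n - 1`. Removing the subtree at a marked vertex, putting in its place a leaf
with a prescribed label `i`, and renumbering the other labels in an order-preserving way, is a
bijection to the triples of an object with a marked leaf, an object, and the set `A` of the labels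
that were used in the subtree. -/
def LabelledGraftable (F : TreeFamily) : Prop :=
  ∃ label : ∀ a : F.Obj, (F.tree a).V ≃ Fin (F.tree a).size,
  ∃ e : (Σ p : F.Marked, Fin (Nat.card {w // ¬ (F.tree p.1).IsDescendant p.2 w} + 1)) ≃
      (Σ q : F.LeafMarked × F.Obj,
        {A : Finset (Fin ((F.tree q.1.1).size - 1 + (F.tree q.2).size)) //
          A.card = (F.tree q.2).size}),
    ∀ z, ∃ g : (F.tree z.1.1).Graft z.1.2 (F.tree (e z).1.1.1) (e z).1.1.2 (F.tree (e z).1.2),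
      (∀ x y : (F.tree (e z).1.2).V, label (e z).1.2 x < label (e z).1.2 y ↔
        label z.1.1 (g.lower x) < label z.1.1 (g.lower y)) ∧
      (∀ x y : (F.tree (e z).1.1.1).V, x ≠ (e z).1.1.2 → y ≠ (e z).1.1.2 →
        (label (e z).1.1.1 x < label (e z).1.1.1 y ↔
          label z.1.1 (g.upper x) < label z.1.1 (g.upper y))) ∧
      (label (e z).1.1.1 (e z).1.1.2 : ℕ) = (z.2 : ℕ) ∧
      (∀ w, (F.tree z.1.1).IsDescendant z.1.2 w ↔
        ∃ j ∈ (e z).2.1, (j : ℕ) = (label z.1.1 w : ℕ))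

/-- A family is graftable if it has the grafting bijection that matches the kind of generating
function in use. -/
def Graftable (F : TreeFamily) : Kind → Prop
  | .ordinary => F.OrdinaryGraftable
  | .exponential => F.LabelledGraftable

/-- The generating function `∑ f(a) x ^ |a|` (ordinary) or `∑ f(a) x ^ |a| / |a|!` (exponential),
where `a` runs over the objects of the family and `|a|` is the number of vertices. -/
def gf (F : TreeFamily) (κ : Kind) (f : F.Obj → ℚ) : PowerSeries ℚ :=
  PowerSeries.mk fun n => ∑ a ∈ (F.finite_size n).toFinset, f a * κ.weight n

/-- `T(x)`, the generating function of trees. -/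
def T (F : TreeFamily) (κ : Kind) : PowerSeries ℚ := F.gf κ fun _ => 1

/-- `V(x)`, the generating function of vertices. -/
def V (F : TreeFamily) (κ : Kind) : PowerSeries ℚ := F.gf κ fun a => ((F.tree a).size : ℚ)

open Classical in
/-- `L(x)`, the generating function of leaves. -/
def L (F : TreeFamily) (κ : Kind) : PowerSeries ℚ :=
  F.gf κ fun a => ∑ l : (F.tree a).V with (F.tree a).IsLeaf l, 1

/-- `L(x) / x`, a power series because there are no trees without vertices
(see `X_mul_LdivX`). -/
def LdivX (F : TreeFamily) (κ : Kind) : PowerSeries ℚ :=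
  PowerSeries.mk fun n => PowerSeries.coeff (n + 1) (F.L κ)

theorem X_mul_LdivX (F : TreeFamily) (κ : Kind) : PowerSeries.X * F.LdivX κ = F.L κ := by
  ext n
  cases n with
  | zero =>
    have h : (F.finite_size 0).toFinset = ∅ := by
      ext a
      have : 0 < (F.tree a).size := Fintype.card_pos_iff.mpr ⟨(F.tree a).root⟩
      simp only [Set.Finite.mem_toFinset, Set.mem_ofPred_eq, Finset.notMem_empty, iff_false]
      omega
    rw [PowerSeries.coeff_zero_X_mul, L, gf, PowerSeries.coeff_mk, h, Finset.sum_empty]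
  | succ n => rw [PowerSeries.coeff_succ_X_mul, LdivX, PowerSeries.coeff_mk]

/-- Paths from the root to an arbitrary vertex, weighted by the `k`-th power of the length. -/
def rootPaths (F : TreeFamily) (κ : Kind) (k : ℕ) : PowerSeries ℚ :=
  F.gf κ fun a => ∑ v, lengthPow k ((F.tree a).dist v (F.tree a).root)

open Classical in
/-- Paths between the root and a leaf, weighted by the `k`-th power of the length. -/
def rootLeafPaths (F : TreeFamily) (κ : Kind) (k : ℕ) : PowerSeries ℚ :=
  F.gf κ fun a => ∑ l with (F.tree a).IsLeaf l, lengthPow k ((F.tree a).dist l (F.tree a).root)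

open Classical in
/-- Paths between an arbitrary vertex and one of its descendants, weighted by the `k`-th power of
the length. -/
def verticalPaths (F : TreeFamily) (κ : Kind) (k : ℕ) : PowerSeries ℚ :=
  F.gf κ fun a => ∑ v, ∑ w with (F.tree a).IsDescendant v w, lengthPow k ((F.tree a).dist v w)

open Classical in
/-- Paths between an arbitrary vertex and one of its descendant leaves, weighted by the `k`-th
power of the length. -/
def verticalLeafPaths (F : TreeFamily) (κ : Kind) (k : ℕ) : PowerSeries ℚ :=
  F.gf κ fun a => ∑ v, ∑ l with (F.tree a).IsDescendant v l ∧ (F.tree a).IsLeaf l,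
    lengthPow k ((F.tree a).dist v l)

end TreeFamily

end PathLengths

end

/-! Fix a weight on path ends (all vertices, or leaves only) and let `E f` be the generating
function of root-to-vertex paths in which a path of length `d` counts `f d`. Sum `f` over all
vertical paths in two ways. By starting vertex: grafting splits a tree at the marked vertex into a
tree with a marked leaf and the subtree, and the path lives in the subtree, so the sum is `(L/x) * E
f` (`Graftable.verticalSum_eq`). By end: the ancestors of a vertex of depth `d` lie at distances `0,
…, d` from it, so the sum is `E (S f)`, where `S` takes partial sums
(`verticalSum_eq_rootSum_partialSum`). Hence `S` acts under `E` as multiplication by `L/x`.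

It remains to write the sequence of `k`-th powers as `P_k(S)` applied to `e = (0, 1, 1, …)`. Let `D`
multiply the `d`-th term by `d`. Then `D S - S D = S² - S` and `D e = S e`, so `D p(S) e = q(S) e`
with `q = y p + (y² - y) p'` (`indexMul_aeval`). Iterating from `P_0 = 1` gives the `P_k`, whose top
coefficients follow from the recursion. -/

noncomputable section

namespace PathLengths

/-! ### Powers as polynomials in the partial-sum operator; leading coefficients. -/

section Polynomials

open Polynomial

/-- The operator that sends a sequence to the sequence of its partial sums. -/
def partialSum : Module.End ℚ (ℕ → ℚ) where
  toFun f d := ∑ i ∈ Finset.range (d + 1), f i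
  map_add' f g := by ext d; simp [Finset.sum_add_distrib]
  map_smul' c f := by ext d; simp [Finset.mul_sum]

theorem partialSum_apply (f : ℕ → ℚ) (d : ℕ) :
    partialSum f d = ∑ i ∈ Finset.range (d + 1), f i := rfl

theorem partialSum_succ (f : ℕ → ℚ) (d : ℕ) :
    partialSum f (d + 1) = partialSum f d + f (d + 1) := by
  simp only [partialSum_apply, Finset.sum_range_succ]

/-- The operator that multiplies the `d`-th term of a sequence by `d`. -/
def indexMul : Module.End ℚ (ℕ → ℚ) where
  toFun f d := d * f d
  map_add' f g := by ext d; simp [mul_add]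
  map_smul' c f := by ext d; simp; ring

theorem indexMul_apply (f : ℕ → ℚ) (d : ℕ) : indexMul f d = d * f d := rfl

/-- The difference of the two orders at `d` is `∑ (d - i) f i` over `i ≤ d`, which is the sum of the
partial sums up to `d - 1`. -/
theorem indexMul_partialSum (f : ℕ → ℚ) :
    indexMul (partialSum f) =
      partialSum (indexMul f) + (partialSum (partialSum f) - partialSum f) := by
  ext d
  simp only [Pi.add_apply, Pi.sub_apply, indexMul_apply]
  induction d with
  | zero => simp [partialSum_apply, indexMul_apply]
  | succ d ih =>
    simp only [partialSum_succ, indexMul_apply] at ih ⊢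
    push_cast
    linear_combination ih

theorem indexMul_lengthPow (k : ℕ) : indexMul (lengthPow k) = lengthPow (k + 1) := by
  ext d
  rw [indexMul_apply, lengthPow, lengthPow]
  split_ifs <;> ring

/-- The convention `0 ^ 0 = 0` enters here: the partial sums of `0, 1, 1, …` are `0, 1, 2, …`. -/
theorem partialSum_lengthPow_zero : partialSum (lengthPow 0) = lengthPow 1 := by
  ext d
  induction d with
  | zero => simp [partialSum_apply, lengthPow]
  | succ d ih =>
    rw [partialSum_succ, ih]
    by_cases h : d = 0 <;> simp [lengthPow, h]

/-- The operator on polynomials that corresponds to `indexMul` when `X` acts as `partialSum`. -/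
def powStep (p : ℚ[X]) : ℚ[X] := X * p + (X ^ 2 - X) * derivative p

/-- The commutator with `indexMul` is a derivation, so it sends `p(S)` to `(S² - S) p'(S)`; the
summand `X * p` comes from `indexMul` acting on `lengthPow 0`. -/
theorem indexMul_aeval (p : ℚ[X]) :
    indexMul (aeval partialSum p (lengthPow 0)) = aeval partialSum (powStep p) (lengthPow 0) := by
  induction p using Polynomial.induction_on' with
  | add p q hp hq =>
    have : powStep (p + q) = powStep p + powStep q := by
      simp only [powStep, derivative_add]; ring
    simp only [this, map_add, LinearMap.add_apply, hp, hq]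
  | monomial m c =>
    have hs (p : ℚ[X]) : powStep (C c * p) = C c * powStep p := by
      simp only [powStep, derivative_C_mul]; ring
    rw [← C_mul_X_pow_eq_monomial, hs]
    simp only [map_mul, aeval_C, Module.End.mul_apply, Module.algebraMap_end_apply, map_smul]
    congr 1
    induction m with
    | zero =>
      simp [powStep, indexMul_lengthPow, partialSum_lengthPow_zero]
    | succ m ih =>
      have hX : powStep (X ^ (m + 1)) = X * powStep (X ^ m) + (X ^ 2 - X) * X ^ m := by
        simp only [powStep, pow_succ' X m, derivative_mul, derivative_X]; ring
      rw [hX, pow_succ']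
      simp only [map_add, map_sub, map_mul, aeval_X, Module.End.mul_apply, LinearMap.add_apply,
        LinearMap.sub_apply, ← ih, indexMul_partialSum, pow_two]

/-- The polynomials that express the moments of the path lengths. -/
def pathPoly : ℕ → ℚ[X]
  | 0 => 1
  | k + 1 => powStep (pathPoly k)

theorem aeval_partialSum_pathPoly (k : ℕ) :
    aeval partialSum (pathPoly k) (lengthPow 0) = lengthPow k := by
  induction k with
  | zero => simp [pathPoly]
  | succ k ih => rw [pathPoly, ← indexMul_aeval, ih, indexMul_lengthPow]

theorem coeff_powStep_zero (p : ℚ[X]) : (powStep p).coeff 0 = 0 := by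
  simp [powStep, coeff_zero_eq_eval_zero]

theorem coeff_powStep_succ (p : ℚ[X]) (m : ℕ) :
    (powStep p).coeff (m + 1) = (m + 1) * (p.coeff m - p.coeff (m + 1)) := by
  rw [powStep, sub_mul, pow_two, mul_assoc, coeff_add, coeff_sub, coeff_X_mul, coeff_X_mul,
    coeff_X_mul, coeff_derivative]
  cases m with
  | zero => simp [sub_eq_add_neg]
  | succ m => rw [coeff_X_mul, coeff_derivative]; push_cast; ring

theorem coeff_pathPoly_of_lt {k m : ℕ} (h : k < m) : (pathPoly k).coeff m = 0 := by
  induction k generalizing m with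
  | zero => simp [pathPoly, coeff_one, h.ne']
  | succ k ih =>
    obtain ⟨m, rfl⟩ : ∃ j, m = j + 1 := ⟨m - 1, by omega⟩
    rw [pathPoly, coeff_powStep_succ, ih (by omega), ih (by omega)]; simp

theorem coeff_pathPoly_self (k : ℕ) : (pathPoly k).coeff k = k.factorial := by
  induction k with
  | zero => simp [pathPoly]
  | succ k ih =>
    rw [pathPoly, coeff_powStep_succ, ih, coeff_pathPoly_of_lt (by omega), Nat.factorial_succ]
    push_cast; ring

theorem coeff_pathPoly_succ_self (k : ℕ) :
    (pathPoly (k + 1)).coeff k = -((k + 1).factorial * k / 2) := by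
  induction k with
  | zero => simp [pathPoly, coeff_powStep_zero]
  | succ k ih =>
    rw [pathPoly, coeff_powStep_succ, ih, coeff_pathPoly_self, Nat.factorial_succ (k + 1)]
    push_cast; ring

/-- The recursion subtracts the next higher coefficient, which is at most `0`, so nothing cancels.
Equality occurs for `2 * X ^ 2 - X`; from the third polynomial on the sign is strict, which fixes
the degree of the remainder. -/
theorem coeff_pathPoly_add_two_nonneg (k : ℕ) : 0 ≤ (pathPoly (k + 2)).coeff k := by
  induction k with
  | zero => simp [pathPoly, coeff_powStep_zero]
  | succ k ih =>
    rw [pathPoly, coeff_powStep_succ, coeff_pathPoly_succ_self]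
    have : (0 : ℚ) ≤ (k + 1 + 1).factorial * (k + 1 : ℕ) / 2 := by positivity
    exact mul_nonneg (by positivity) (by linarith)

theorem coeff_pathPoly_add_three_pos (k : ℕ) : 0 < (pathPoly (k + 3)).coeff (k + 1) := by
  rw [pathPoly, coeff_powStep_succ, coeff_pathPoly_succ_self]
  have := coeff_pathPoly_add_two_nonneg k
  have : (0 : ℚ) < (k + 1 + 1).factorial * (k + 1 : ℕ) / 2 := by positivity
  exact mul_pos (by positivity) (by linarith)

/-- What remains of `pathPoly k` without its two leading terms. -/
def pathPolyRest (k : ℕ) : ℚ[X] :=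
  -- At `k = 0` the exponent `k - 1` truncates to `0` and the difference would be the constant
  -- `-1/2`, not `0`.
  if k = 0 then 0 else pathPoly k - (C (k.factorial : ℚ) * X ^ k
    - C ((k.factorial : ℚ) * ((k : ℚ) - 1) / 2) * X ^ (k - 1))

theorem pathPoly_eq {k : ℕ} (hk : 1 ≤ k) : pathPoly k = C (k.factorial : ℚ) * X ^ k
    - C ((k.factorial : ℚ) * ((k : ℚ) - 1) / 2) * X ^ (k - 1) + pathPolyRest k := by
  rw [pathPolyRest, if_neg (by omega)]; ring

theorem coeff_pathPolyRest_succ (k m : ℕ) : (pathPolyRest (k + 1)).coeff m =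
    if m < k then (pathPoly (k + 1)).coeff m else 0 := by
  rw [pathPolyRest, if_neg (by omega)]
  simp only [coeff_sub, coeff_C_mul_X_pow, Nat.add_sub_cancel]
  obtain rfl | rfl | h | h : m = k + 1 ∨ m = k ∨ k + 1 < m ∨ m < k := by omega
  · simp [coeff_pathPoly_self]
  · simp only [coeff_pathPoly_succ_self]; simp
  · simp [coeff_pathPoly_of_lt h, show m ≠ k + 1 by omega, show m ≠ k by omega,
      show ¬ m < k by omega]
  · simp [show m ≠ k + 1 by omega, show m ≠ k by omega, h]

theorem pathPolyRest_of_lt_two {k : ℕ} (hk : k < 2) : pathPolyRest k = 0 := by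
  obtain rfl | rfl : k = 0 ∨ k = 1 := by omega
  · simp [pathPolyRest]
  · ext m; simp [coeff_pathPolyRest_succ 0]

theorem natDegree_pathPolyRest {k : ℕ} (hk : 2 ≤ k) : (pathPolyRest k).natDegree = k - 2 := by
  obtain ⟨k, rfl⟩ : ∃ j, k = j + 2 := ⟨k - 2, by omega⟩
  have hle : (pathPolyRest (k + 2)).natDegree ≤ k := by
    rw [natDegree_le_iff_coeff_eq_zero]
    intro m hm
    rw [coeff_pathPolyRest_succ, if_neg (by omega)]
  rw [Nat.add_sub_cancel]
  cases k with
  | zero => omega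
  | succ k =>
    refine natDegree_eq_of_le_of_coeff_ne_zero hle ?_
    rw [coeff_pathPolyRest_succ, if_pos (by omega)]
    exact (coeff_pathPoly_add_three_pos k).ne'

/-- A linear functional that turns partial sums into multiplication by `ℓ` turns polynomials in
partial sums into polynomials in `ℓ`. -/
theorem map_aeval_partialSum {A : Type*} [CommRing A] [Algebra ℚ A] (E : (ℕ → ℚ) →ₗ[ℚ] A) (ℓ : A)
    (h : ∀ f, E (partialSum f) = ℓ * E f) (p : ℚ[X]) (f : ℕ → ℚ) :
    E (aeval partialSum p f) = aeval ℓ p * E f := by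
  induction p using Polynomial.induction_on' with
  | add p q hp hq => simp only [map_add, LinearMap.add_apply, hp, hq, add_mul]
  | monomial m c =>
    rw [← C_mul_X_pow_eq_monomial]
    simp only [map_mul, aeval_C, Module.End.mul_apply, Module.algebraMap_end_apply, map_smul,
      map_pow, aeval_X, mul_assoc]
    rw [← Algebra.smul_def]
    congr 1
    induction m with
    | zero => simp
    | succ m ih => rw [pow_succ', Module.End.mul_apply, h, ih, pow_succ', mul_assoc]

end Polynomials

/-! ### Depth, parents and ancestors in a rooted tree. -/

namespace FinRootedTree

variable {t s t' : FinRootedTree} {u v w c p : t.V}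

theorem dist_triangle (t : FinRootedTree) (u v w : t.V) : t.dist u w ≤ t.dist u v + t.dist v w :=
  t.isTree.connected.dist_triangle

theorem dist_comm (t : FinRootedTree) (u v : t.V) : t.dist u v = t.dist v u :=
  SimpleGraph.dist_comm

theorem dist_self (t : FinRootedTree) (v : t.V) : t.dist v v = 0 := SimpleGraph.dist_self

theorem dist_eq_zero_iff : t.dist u v = 0 ↔ u = v := t.isTree.connected.dist_eq_zero_iff

theorem dist_eq_length {p : t.graph.Walk u v} (hp : p.IsPath) : t.dist u v = p.length := by
  obtain ⟨q, hq, hl⟩ := t.isTree.connected.exists_path_of_dist u v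
  rw [(t.isTree.existsUnique_path u v).unique hp hq]
  exact hl.symm

theorem IsChild.dist_root (h : t.IsChild p c) : t.dist t.root c = t.dist t.root p + 1 := by
  have h1 := t.dist_triangle t.root p c
  have h2 : t.dist p c = 1 := SimpleGraph.dist_eq_one_iff_adj.mpr h.1
  have := h.2
  omega

theorem IsDescendant.refl (v : t.V) : t.IsDescendant v v := Relation.ReflTransGen.refl

theorem IsDescendant.tail (h : t.IsDescendant v p) (hc : t.IsChild p c) : t.IsDescendant v c :=
  Relation.ReflTransGen.tail h hc

/-- Each step to a child raises the depth by exactly one, which forces equality in the triangle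
inequality. -/
theorem IsDescendant.dist_root (h : t.IsDescendant v w) :
    t.dist t.root w = t.dist t.root v + t.dist v w := by
  induction h with
  | refl => simp [dist_self]
  | @tail w c _ hc ih =>
    have h1 := t.dist_triangle t.root v c
    have h2 := t.dist_triangle v w c
    have h3 : t.dist w c = 1 := SimpleGraph.dist_eq_one_iff_adj.mpr hc.1
    have := hc.dist_root
    omega

/-- Geodesics from the root to either parent extend to geodesics to `c`; these coincide in a tree,
hence so do their penultimate vertices. -/
theorem IsChild.parent_unique {q : t.V} (hp : t.IsChild p c) (hq : t.IsChild q c) : p = q := by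
  obtain ⟨P, hP, hPl⟩ := t.isTree.connected.exists_path_of_dist t.root p
  obtain ⟨Q, hQ, hQl⟩ := t.isTree.connected.exists_path_of_dist t.root q
  have h1 : (P.concat hp.1).length = t.graph.dist t.root c := by
    rw [SimpleGraph.Walk.length_concat, hPl]; exact hp.dist_root.symm
  have h2 : (Q.concat hq.1).length = t.graph.dist t.root c := by
    rw [SimpleGraph.Walk.length_concat, hQl]; exact hq.dist_root.symm
  have := (t.isTree.existsUnique_path t.root c).unique
    (SimpleGraph.Walk.isPath_of_length_eq_dist _ h1)
    (SimpleGraph.Walk.isPath_of_length_eq_dist _ h2)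
  simpa using congrArg SimpleGraph.Walk.penultimate this

theorem exists_parent (h : c ≠ t.root) : ∃ p, t.IsChild p c := by
  obtain ⟨P, hP, hPl⟩ := t.isTree.connected.exists_path_of_dist t.root c
  have hn : ¬ P.Nil := fun hn => h hn.eq.symm
  refine ⟨P.penultimate, P.adj_penultimate hn, ?_⟩
  have h1 := SimpleGraph.dist_le P.dropLast
  have h2 : P.dropLast.length + 1 = P.length := by
    rw [SimpleGraph.Walk.length_dropLast]
    have := SimpleGraph.Walk.not_nil_iff_lt_length.mp hn
    omega
  change t.graph.dist _ _ < t.graph.dist _ _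
  omega

open Classical in
/-- The ancestors of `w` are at the distances `0, …, d` from `w`, where `d` is the depth of `w`. -/
theorem sum_ancestors (t : FinRootedTree) (f : ℕ → ℚ) (w : t.V) :
    ∑ v with t.IsDescendant v w, f (t.dist v w) =
      ∑ i ∈ Finset.range (t.dist t.root w + 1), f i := by
  induction hd : t.dist t.root w generalizing w f with
  | zero =>
    rw [dist_eq_zero_iff] at hd
    subst hd
    have : ({v | t.IsDescendant v t.root} : Finset t.V) = {t.root} := by
      ext v
      simp only [Finset.mem_filter, Finset.mem_univ, true_and, Finset.mem_singleton]
      refine ⟨fun h => ?_, fun h => h ▸ .refl _⟩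
      have := h.dist_root
      rw [dist_self] at this
      exact dist_eq_zero_iff.mp (by omega)
    rw [this]
    simp [dist_self]
  | succ d ih =>
    have hw : w ≠ t.root := by
      rintro rfl
      simp [dist_self] at hd
    obtain ⟨p, hp⟩ := exists_parent hw
    have hdp := hp.dist_root
    have key (v : t.V) (hv : t.IsDescendant v p) : t.dist v w = t.dist v p + 1 := by
      have h1 := hv.dist_root
      have h2 := (hv.tail hp).dist_root
      omega
    have : Finset.univ.filter (t.IsDescendant · w) =
        insert w (Finset.univ.filter (t.IsDescendant · p)) := by
      ext v
      simp only [Finset.mem_filter, Finset.mem_univ, true_and, Finset.mem_insert]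
      constructor
      · intro h
        rcases Relation.ReflTransGen.cases_tail h with h | ⟨q, hq, hqw⟩
        · exact .inl h.symm
        · exact .inr (hqw.parent_unique hp ▸ hq)
      · rintro (rfl | h)
        · exact .refl _
        · exact h.tail hp
    -- The vertex `w` itself contributes `f 0`. Its other ancestors are those of its parent `p`, one
    -- step farther away, hence the induction hypothesis for the shifted `f`.
    rw [this, Finset.sum_insert, Finset.sum_range_succ', dist_self, add_comm,
      ← ih (fun i => f (i + 1)) p (by omega)]
    · congr 1
      refine Finset.sum_congr rfl fun v hv => ?_
      rw [key v (by simpa using hv)]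
    · simp only [Finset.mem_filter, Finset.mem_univ, true_and]
      intro h
      have := h.dist_root
      omega

theorem size_eq_one_iff_isLeaf_root : t.size = 1 ↔ t.IsLeaf t.root := by
  rw [size, Fintype.card_eq_one_iff]
  constructor
  · rintro ⟨x, hx⟩ c hc
    exact hc.1.ne ((hx _).trans (hx c).symm)
  · intro h
    refine ⟨t.root, fun y => ?_⟩
    by_contra hy
    obtain ⟨q⟩ := t.isTree.connected.preconnected t.root y
    have hn : ¬ q.Nil := fun hn => hy hn.eq.symm
    have hadj := q.adj_snd hn
    refine h _ ⟨hadj, ?_⟩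
    rw [dist_self, show t.dist t.root q.snd = 1 from SimpleGraph.dist_eq_one_iff_adj.mpr hadj]
    exact one_pos

/-! ### What a grafted subtree inherits. -/

namespace Graft

variable {l : s.V} (g : t.Graft v s l t')

include g

theorem isDescendant_lower (x : t'.V) : t.IsDescendant v (g.lower x) := (g.lower x).2

/-- An embedding carries paths to paths, and in a tree every path is a geodesic. -/
theorem dist_lower (x y : t'.V) : t.dist (g.lower x) (g.lower y) = t'.dist x y := by
  obtain ⟨p, hp, hl⟩ := t'.isTree.connected.exists_path_of_dist x y
  let φ : t'.graph ↪g t.graph := (SimpleGraph.Embedding.induce _).comp g.lower.toEmbedding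
  have h : (p.map φ.toHom).IsPath := hp.map φ.injective
  have := dist_eq_length h
  rw [SimpleGraph.Walk.length_map, hl] at this
  exact this

theorem dist_root_lower (x : t'.V) : t.dist v (g.lower x) = t'.dist t'.root x := by
  rw [← g.dist_lower, g.lower_root]

theorem isChild_lower (x y : t'.V) : t.IsChild (g.lower x) (g.lower y) ↔ t'.IsChild x y := by
  have h : t.graph.Adj (g.lower x) (g.lower y) ↔ t'.graph.Adj x y := g.lower.map_rel_iff
  rw [IsChild, IsChild, h, (g.isDescendant_lower x).dist_root, (g.isDescendant_lower y).dist_root,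
    g.dist_root_lower, g.dist_root_lower, Nat.add_lt_add_iff_left]

/-- Children of a descendant of `v` are again descendants of `v`, so passing to the subtree loses no
child. -/
theorem isLeaf_lower (x : t'.V) : t.IsLeaf (g.lower x) ↔ t'.IsLeaf x := by
  constructor
  · intro h y hy
    exact h _ ((g.isChild_lower x y).mpr hy)
  · intro h c hc
    obtain ⟨y, hy⟩ := g.lower.surjective ⟨c, (g.isDescendant_lower x).tail hc⟩
    have : c = g.lower y := by rw [hy]
    rw [this, g.isChild_lower] at hc
    exact h y hc

open Classical in
theorem sum_descendants (f : t.V → ℚ) :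
    ∑ w with t.IsDescendant v w, f w = ∑ x, f (g.lower x) := by
  rw [Finset.sum_subtype (p := fun w => w ∈ {w | t.IsDescendant v w}) _ (by simp)]
  exact (Fintype.sum_equiv g.lower.toEquiv _ _ fun _ => rfl).symm

theorem card_descendants : Nat.card {w // t.IsDescendant v w} = t'.size := by
  rw [size, ← Nat.card_eq_fintype_card]
  exact (Nat.card_congr g.lower.toEquiv).symm

theorem card_not_isDescendant : Nat.card {w // ¬ t.IsDescendant v w} + 1 = s.size := by
  classical
  rw [size, ← Nat.card_eq_fintype_card, Nat.card_congr g.upper.toEquiv]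
  have : {w | w = v ∨ ¬ t.IsDescendant v w} = insert v {w | ¬ t.IsDescendant v w} := rfl
  rw [this, Nat.card_coe_set_eq, Set.ncard_insert_of_notMem]
  · rfl
  · simpa using IsDescendant.refl v

theorem size_eq : t.size = s.size - 1 + t'.size := by
  classical
  rw [← g.card_descendants, ← g.card_not_isDescendant, Nat.add_sub_cancel, add_comm, size]
  simp only [Nat.card_eq_fintype_card]
  rw [Fintype.card_subtype_compl]
  have := Fintype.card_subtype_le (t.IsDescendant v)
  omega

end Graft
end FinRootedTree

/-! ### Generating functions and the grafting bijection. -/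

namespace TreeFamily

open FinRootedTree

theorem coeff_gf (F : TreeFamily) (κ : Kind) (f : F.Obj → ℚ) (n : ℕ) :
    PowerSeries.coeff n (F.gf κ f) = ∑ a ∈ (F.finite_size n).toFinset, f a * κ.weight n :=
  PowerSeries.coeff_mk _ _

theorem gf_add (F : TreeFamily) (κ : Kind) (f g : F.Obj → ℚ) :
    F.gf κ (fun a => f a + g a) = F.gf κ f + F.gf κ g := by
  ext n
  simp only [map_add, coeff_gf, add_mul, Finset.sum_add_distrib]

theorem gf_smul (F : TreeFamily) (κ : Kind) (c : ℚ) (f : F.Obj → ℚ) :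
    F.gf κ (fun a => c * f a) = c • F.gf κ f := by
  ext n
  simp only [PowerSeries.coeff_smul, coeff_gf, smul_eq_mul, Finset.mul_sum, mul_assoc]

theorem gf_sub (F : TreeFamily) (κ : Kind) (f g : F.Obj → ℚ) :
    F.gf κ (fun a => f a - g a) = F.gf κ f - F.gf κ g := by
  ext n
  simp only [map_sub, coeff_gf, sub_mul, Finset.sum_sub_distrib]

/-- The objects with a marked vertex that have `n` vertices. -/
def markedFinset (F : TreeFamily) (n : ℕ) : Finset F.Marked :=
  (F.finite_size n).toFinset.sigma fun _ => Finset.univ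

open Classical in
/-- The objects with a marked leaf that have `n` vertices. -/
def leafMarkedFinset (F : TreeFamily) (n : ℕ) : Finset F.LeafMarked :=
  (F.finite_size n).toFinset.sigma fun _ => Finset.univ

open Classical in
/-- The pairs of an object with a marked leaf and an object that yield trees with `n` vertices when
they are grafted. -/
def graftFinset (F : TreeFamily) (n : ℕ) : Finset (F.LeafMarked × F.Obj) :=
  (Finset.HasAntidiagonal.antidiagonal n).biUnion fun ij =>
    -- The marked leaf and the root of the grafted tree become one vertex; the shift by one matches
    -- the division of `L` by `x`.
    F.leafMarkedFinset (ij.1 + 1) ×ˢ (F.finite_size ij.2).toFinset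

theorem mem_markedFinset {F : TreeFamily} {n : ℕ} {p : F.Marked} :
    p ∈ F.markedFinset n ↔ (F.tree p.1).size = n := by
  simp [markedFinset]

theorem mem_leafMarkedFinset {F : TreeFamily} {n : ℕ} {q : F.LeafMarked} :
    q ∈ F.leafMarkedFinset n ↔ (F.tree q.1).size = n := by
  simp [leafMarkedFinset]

theorem size_pos (t : FinRootedTree) : 0 < t.size := Fintype.card_pos_iff.mpr ⟨t.root⟩

theorem mem_graftFinset {F : TreeFamily} {n : ℕ} {x : F.LeafMarked × F.Obj} :
    x ∈ F.graftFinset n ↔ (F.tree x.1.1).size - 1 + (F.tree x.2).size = n := by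
  have := size_pos (F.tree x.1.1)
  simp only [graftFinset, Finset.mem_biUnion, Finset.HasAntidiagonal.mem_antidiagonal, Finset.mem_product,
    mem_leafMarkedFinset, Set.Finite.mem_toFinset, Set.mem_ofPred_eq, Prod.exists]
  constructor
  · rintro ⟨i, j, h, h1, h2⟩
    omega
  · intro h
    exact ⟨_, _, h, by omega, rfl⟩

theorem sum_graftFinset (F : TreeFamily) (n : ℕ) (f : F.LeafMarked × F.Obj → ℚ) :
    ∑ x ∈ F.graftFinset n, f x = ∑ ij ∈ Finset.HasAntidiagonal.antidiagonal n,
      ∑ q ∈ F.leafMarkedFinset (ij.1 + 1), ∑ c ∈ (F.finite_size ij.2).toFinset, f (q, c) := by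
  classical
  rw [graftFinset, Finset.sum_biUnion]
  · exact Finset.sum_congr rfl fun ij _ => Finset.sum_product _ _ _
  · intro ij _ ij' _ hne
    rw [Function.onFun, Finset.disjoint_left]
    intro x hx hx'
    simp only [Finset.mem_product, mem_leafMarkedFinset, Set.Finite.mem_toFinset,
      Set.mem_ofPred_eq] at hx hx'
    exact hne (Prod.ext (by omega) (by omega))

theorem coeff_LdivX (F : TreeFamily) (κ : Kind) (n : ℕ) :
    PowerSeries.coeff n (F.LdivX κ) = ∑ _q ∈ F.leafMarkedFinset (n + 1), κ.weight (n + 1) := by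
  classical
  rw [LdivX, PowerSeries.coeff_mk, L, coeff_gf, leafMarkedFinset, Finset.sum_sigma]
  refine Finset.sum_congr rfl fun a _ => ?_
  rw [Finset.sum_const, Finset.sum_const, nsmul_one, nsmul_eq_mul, Finset.card_univ,
    Fintype.card_subtype]

/-- The statistic `Φ` of objects with a marked vertex depends only on the subtree at the marked
vertex: its value is that of `Ψ` for this subtree. -/
def DependsOnLower (F : TreeFamily) (Φ : F.Marked → ℚ) (Ψ : F.Obj → ℚ) : Prop :=
  ∀ (p : F.Marked) (q : F.LeafMarked) (c : F.Obj),
    (F.tree p.1).Graft p.2 (F.tree q.1) q.2 (F.tree c) → Φ p = Ψ c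

theorem OrdinaryGraftable.sum_markedFinset {F : TreeFamily} (h : F.OrdinaryGraftable)
    {Φ : F.Marked → ℚ} {Ψ : F.Obj → ℚ} (hΦ : F.DependsOnLower Φ Ψ) (n : ℕ) :
    ∑ p ∈ F.markedFinset n, Φ p = ∑ x ∈ F.graftFinset n, Ψ x.2 := by
  obtain ⟨e, he⟩ := h
  refine Finset.sum_equiv e (fun p => ?_) fun p _ => ?_
  · obtain ⟨g⟩ := he p
    rw [mem_markedFinset, mem_graftFinset, g.size_eq]
  · obtain ⟨g⟩ := he p
    exact hΦ _ _ _ g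

/-- Each marked tree occurs once per admissible leaf label, as many times as the upper tree has
vertices; each pair on the other side occurs once per label set, a binomial coefficient. Dividing by
the first count inside the sum gives the quotient. -/
theorem LabelledGraftable.sum_markedFinset {F : TreeFamily} (h : F.LabelledGraftable)
    {Φ : F.Marked → ℚ} {Ψ : F.Obj → ℚ} (hΦ : F.DependsOnLower Φ Ψ) (n : ℕ) :
    ∑ p ∈ F.markedFinset n, Φ p =
      ∑ x ∈ F.graftFinset n, n.choose (F.tree x.2).size / (F.tree x.1.1).size * Ψ x.2 := by
  obtain ⟨label, e, he⟩ := h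
  calc ∑ p ∈ F.markedFinset n, Φ p
      = ∑ z ∈ (F.markedFinset n).sigma fun p =>
          (Finset.univ : Finset (Fin (Nat.card {w // ¬ (F.tree p.1).IsDescendant p.2 w} + 1))),
          Φ z.1 / (Nat.card {w // ¬ (F.tree z.1.1).IsDescendant z.1.2 w} + 1 : ℕ) := by
        rw [Finset.sum_sigma]
        refine Finset.sum_congr rfl fun p _ => ?_
        dsimp only
        rw [Finset.sum_const, Finset.card_univ, Fintype.card_fin, nsmul_eq_mul, mul_div_cancel₀]
        exact Nat.cast_ne_zero.mpr (Nat.succ_ne_zero _)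
    _ = ∑ y ∈ (F.graftFinset n).sigma fun x => (Finset.univ : Finset
          {A : Finset (Fin ((F.tree x.1.1).size - 1 + (F.tree x.2).size)) //
            A.card = (F.tree x.2).size}),
          Ψ y.1.2 / (F.tree y.1.1.1).size := by
        refine Finset.sum_equiv e (fun z => ?_) fun z _ => ?_
        · obtain ⟨g, -⟩ := he z
          simp only [Finset.mem_sigma, Finset.mem_univ, and_true]
          rw [mem_markedFinset, mem_graftFinset, g.size_eq]
        · obtain ⟨g, -⟩ := he z
          rw [g.card_not_isDescendant, hΦ _ _ _ g]
    _ = _ := by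
        rw [Finset.sum_sigma]
        refine Finset.sum_congr rfl fun x hx => ?_
        rw [mem_graftFinset] at hx
        dsimp only
        rw [Finset.sum_const, Finset.card_univ, Fintype.card_finset_len, Fintype.card_fin, hx,
          nsmul_eq_mul]
        ring

theorem Graftable.sum_markedFinset {F : TreeFamily} {κ : Kind} (h : F.Graftable κ)
    {Φ : F.Marked → ℚ} {Ψ : F.Obj → ℚ} (hΦ : F.DependsOnLower Φ Ψ) (n : ℕ) :
    (∑ p ∈ F.markedFinset n, Φ p) * κ.weight n = ∑ x ∈ F.graftFinset n,
      κ.weight (F.tree x.1.1).size * (Ψ x.2 * κ.weight (F.tree x.2).size) := by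
  cases κ with
  | ordinary => simp [Kind.weight, OrdinaryGraftable.sum_markedFinset h hΦ n]
  | exponential =>
    rw [LabelledGraftable.sum_markedFinset h hΦ n, Finset.sum_mul]
    refine Finset.sum_congr rfl fun x hx => ?_
    rw [mem_graftFinset] at hx
    obtain ⟨m, hm⟩ : ∃ m, (F.tree x.1.1).size = m + 1 :=
      ⟨_, (Nat.succ_pred_eq_of_pos (size_pos _)).symm⟩
    rw [hm, Nat.add_sub_cancel] at hx
    subst hx
    -- With `j` the size of the lower tree, the binomial coefficient over `(m + j)!` is `1 / (m!
    -- j!)`; the factor `1 / (m + 1)` for the leaf label completes `1 / (m + 1)!`.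
    have h1 : ((m + (F.tree x.2).size).choose (F.tree x.2).size : ℚ) * m.factorial *
        (F.tree x.2).size.factorial = (m + (F.tree x.2).size).factorial := by
      exact_mod_cast Nat.add_choose_mul_factorial_mul_factorial m (F.tree x.2).size
    have h2 : ((m + (F.tree x.2).size).choose (F.tree x.2).size : ℚ) ≠ 0 :=
      Nat.cast_ne_zero.mpr (Nat.choose_pos (Nat.le_add_left _ _)).ne'
    simp only [Kind.weight, hm, Nat.factorial_succ, ← h1]
    push_cast
    field_simp

/-- The generating function of a statistic that depends only on the subtree at a marked vertex. -/
theorem Graftable.gf_marked {F : TreeFamily} {κ : Kind} (h : F.Graftable κ)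
    {Φ : F.Marked → ℚ} {Ψ : F.Obj → ℚ} (hΦ : F.DependsOnLower Φ Ψ) :
    F.gf κ (fun a => ∑ v, Φ ⟨a, v⟩) = F.LdivX κ * F.gf κ Ψ := by
  ext n
  have := h.sum_markedFinset hΦ n
  rw [markedFinset, Finset.sum_sigma, sum_graftFinset, Finset.sum_mul] at this
  rw [coeff_gf, this, PowerSeries.coeff_mul]
  refine Finset.sum_congr rfl fun ij _ => ?_
  rw [coeff_LdivX, coeff_gf, Finset.sum_mul_sum]
  refine Finset.sum_congr rfl fun q hq => Finset.sum_congr rfl fun c hc => ?_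
  rw [mem_leafMarkedFinset] at hq
  simp only [Set.Finite.mem_toFinset, Set.mem_ofPred_eq] at hc
  rw [hq, hc]

/-! ### Counting vertical paths in two ways. -/

/-- A weight on the vertices of rooted trees is local if the weight of a descendant of `v` can be
read off from the subtree at `v`. -/
def IsLocal.{u} (χ : ∀ t : FinRootedTree.{u}, t.V → ℚ) : Prop :=
  ∀ ⦃t : FinRootedTree.{u}⦄ ⦃v : t.V⦄ ⦃s : FinRootedTree.{u}⦄ ⦃l : s.V⦄ ⦃t' : FinRootedTree.{u}⦄
    (g : t.Graft v s l t') (x : t'.V), χ t (g.lower x) = χ t' x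

/-- The paths from the root to the vertices, with weights that depend on the end and the length. -/
def rootSum (F : TreeFamily) (κ : Kind) (χ : ∀ t : FinRootedTree, t.V → ℚ) :
    (ℕ → ℚ) →ₗ[ℚ] PowerSeries ℚ where
  toFun f := F.gf κ fun a => ∑ w, χ _ w * f ((F.tree a).dist (F.tree a).root w)
  map_add' f g := by simp only [← gf_add, Pi.add_apply, mul_add, Finset.sum_add_distrib]
  map_smul' c f := by
    simp only [← gf_smul, Pi.smul_apply, smul_eq_mul, Finset.mul_sum, mul_left_comm,
      RingHom.id_apply]

theorem rootSum_apply (F : TreeFamily) (κ : Kind) (χ : ∀ t : FinRootedTree, t.V → ℚ)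
    (f : ℕ → ℚ) : F.rootSum κ χ f =
      F.gf κ fun a => ∑ w, χ _ w * f ((F.tree a).dist (F.tree a).root w) := rfl

open Classical in
/-- The paths from vertices to their descendants, with weights that depend on the end and the
length. -/
def verticalSum (F : TreeFamily) (κ : Kind) (χ : ∀ t : FinRootedTree, t.V → ℚ) (f : ℕ → ℚ) :
    PowerSeries ℚ :=
  F.gf κ fun a => ∑ v, ∑ w with (F.tree a).IsDescendant v w, χ _ w * f ((F.tree a).dist v w)

/-- Mark the start of the path: locality and preservation of distances make the inner sum a
statistic of the grafted subtree alone. -/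
theorem Graftable.verticalSum_eq {F : TreeFamily} {κ : Kind} (h : F.Graftable κ)
    {χ : ∀ t : FinRootedTree, t.V → ℚ} (hχ : IsLocal χ) (f : ℕ → ℚ) :
    F.verticalSum κ χ f = F.LdivX κ * F.rootSum κ χ f := by
  classical
  rw [rootSum_apply, ← h.gf_marked (Φ := fun p => ∑ w with (F.tree p.1).IsDescendant p.2 w,
    χ _ w * f ((F.tree p.1).dist p.2 w)), verticalSum]
  intro p q c g
  dsimp only
  rw [g.sum_descendants]
  simp only [hχ g, g.dist_root_lower]

/-- Sum over the start first, with the end fixed; no grafting is involved. -/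
theorem verticalSum_eq_rootSum_partialSum (F : TreeFamily) (κ : Kind)
    (χ : ∀ t : FinRootedTree, t.V → ℚ) (f : ℕ → ℚ) :
    F.verticalSum κ χ f = F.rootSum κ χ (partialSum f) := by
  classical
  rw [rootSum_apply, verticalSum]
  congr 1
  funext a
  simp only [Finset.sum_filter]
  rw [Finset.sum_comm]
  refine Finset.sum_congr rfl fun w _ => ?_
  rw [← Finset.sum_filter, ← Finset.mul_sum, sum_ancestors, partialSum_apply]

theorem Graftable.rootSum_lengthPow {F : TreeFamily} {κ : Kind} (h : F.Graftable κ)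
    {χ : ∀ t : FinRootedTree, t.V → ℚ} (hχ : IsLocal χ) (k : ℕ) :
    F.rootSum κ χ (lengthPow k) =
      Polynomial.aeval (F.LdivX κ) (pathPoly k) * F.rootSum κ χ (lengthPow 0) := by
  rw [← aeval_partialSum_pathPoly, map_aeval_partialSum _ (F.LdivX κ)]
  intro f
  rw [← verticalSum_eq_rootSum_partialSum, h.verticalSum_eq hχ]

open Classical in
/-- The weight that singles out the leaves. -/
def leafWeight (t : FinRootedTree) (v : t.V) : ℚ := if t.IsLeaf v then 1 else 0

theorem isLocal_one : IsLocal fun _ _ => 1 := fun _ _ _ _ _ _ _ => rfl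

theorem isLocal_leafWeight : IsLocal leafWeight := fun _ _ _ _ _ g x => by
  rw [leafWeight, leafWeight, g.isLeaf_lower]

/-! ### Specialization to all vertices and to leaves. -/

theorem rootPaths_eq (F : TreeFamily) (κ : Kind) (k : ℕ) :
    F.rootPaths κ k = F.rootSum κ (fun _ _ => 1) (lengthPow k) := by
  simp only [rootPaths, rootSum_apply, one_mul, FinRootedTree.dist_comm _ _ (F.tree _).root]

theorem rootLeafPaths_eq (F : TreeFamily) (κ : Kind) (k : ℕ) :
    F.rootLeafPaths κ k = F.rootSum κ leafWeight (lengthPow k) := by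
  simp only [rootLeafPaths, rootSum_apply, leafWeight, ite_mul, one_mul, zero_mul,
    Finset.sum_filter, FinRootedTree.dist_comm _ _ (F.tree _).root]

theorem verticalPaths_eq (F : TreeFamily) (κ : Kind) (k : ℕ) :
    F.verticalPaths κ k = F.verticalSum κ (fun _ _ => 1) (lengthPow k) := by
  simp only [verticalPaths, verticalSum, one_mul]

theorem verticalLeafPaths_eq (F : TreeFamily) (κ : Kind) (k : ℕ) :
    F.verticalLeafPaths κ k = F.verticalSum κ leafWeight (lengthPow k) := by
  classical
  simp only [verticalLeafPaths, verticalSum, leafWeight, ite_mul, one_mul, zero_mul,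
    ← Finset.sum_filter, Finset.filter_filter]

/-- Only the root is at distance `0`. This is the source of the corrections `-T(x)` and `-t₁x`, the
latter because the root is a leaf only in a one-vertex tree. -/
theorem sum_mul_lengthPow_zero (t : FinRootedTree) (χ : t.V → ℚ) :
    ∑ w, χ w * lengthPow 0 (t.dist t.root w) = ∑ w, χ w - χ t.root := by
  classical
  have (w : t.V) : χ w * lengthPow 0 (t.dist t.root w) = χ w - if t.root = w then χ w else 0 := by
    simp only [lengthPow, dist_eq_zero_iff]
    split_ifs <;> simp
  simp [this]

theorem rootSum_one_lengthPow_zero (F : TreeFamily) (κ : Kind) :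
    F.rootSum κ (fun _ _ => 1) (lengthPow 0) = F.V κ - F.T κ := by
  rw [V, T, ← gf_sub, rootSum_apply]
  congr 1
  funext a
  rw [sum_mul_lengthPow_zero]
  simp [size]

theorem gf_leafWeight_root (F : TreeFamily) (κ : Kind) :
    F.gf κ (fun a => leafWeight _ (F.tree a).root) =
      PowerSeries.C (PowerSeries.coeff 1 (F.T κ)) * PowerSeries.X := by
  classical
  ext n
  rw [PowerSeries.coeff_C_mul, PowerSeries.coeff_X, T, coeff_gf, coeff_gf]
  split_ifs with hn
  · subst hn
    rw [mul_one]
    refine Finset.sum_congr rfl fun a ha => ?_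
    simp only [Set.Finite.mem_toFinset, Set.mem_ofPred_eq] at ha
    rw [leafWeight, if_pos (size_eq_one_iff_isLeaf_root.mp ha)]
  · rw [mul_zero]
    refine Finset.sum_eq_zero fun a ha => ?_
    simp only [Set.Finite.mem_toFinset, Set.mem_ofPred_eq] at ha
    rw [leafWeight, if_neg, zero_mul]
    rw [← size_eq_one_iff_isLeaf_root, ha]
    exact hn

theorem rootSum_leafWeight_lengthPow_zero (F : TreeFamily) (κ : Kind) :
    F.rootSum κ leafWeight (lengthPow 0) =
      F.L κ - PowerSeries.C (PowerSeries.coeff 1 (F.T κ)) * PowerSeries.X := by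
  rw [← gf_leafWeight_root, L, ← gf_sub, rootSum_apply]
  congr 1
  funext a
  rw [sum_mul_lengthPow_zero]
  simp only [leafWeight, Finset.sum_filter]

end TreeFamily

end PathLengths

end

theorem corollary2p3 :
    ∃ P Q : ℕ → Polynomial ℚ,
      -- the shape of the polynomials `P k`, which do not depend on the family
      P 0 = 1 ∧
      (∀ k : ℕ, 1 ≤ k → P k =
        Polynomial.C (k.factorial : ℚ) * Polynomial.X ^ k
          - Polynomial.C ((k.factorial : ℚ) * ((k : ℚ) - 1) / 2) * Polynomial.X ^ (k - 1)
          + Q k) ∧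
      (∀ k : ℕ, k < 2 → Q k = 0) ∧
      (∀ k : ℕ, 2 ≤ k → (Q k).natDegree = k - 2) ∧
      ∀ (F : PathLengths.TreeFamily) (κ : PathLengths.Kind), F.Graftable κ → ∀ k : ℕ,
        -- paths from the root; this identity says which polynomial `P k` is
        F.rootPaths κ k = Polynomial.aeval (F.LdivX κ) (P k) * (F.V κ - F.T κ) ∧
        -- (1) paths between the root and a leaf
        F.rootLeafPaths κ k = Polynomial.aeval (F.LdivX κ) (P k) *
          (F.L κ - PowerSeries.C (PowerSeries.coeff 1 (F.T κ)) * PowerSeries.X) ∧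
        -- (2) paths between a vertex and one of its descendants
        F.verticalPaths κ k =
          Polynomial.aeval (F.LdivX κ) (P k) * F.LdivX κ * (F.V κ - F.T κ) ∧
        -- (3) paths between a vertex and one of its descendant leaves
        F.verticalLeafPaths κ k = Polynomial.aeval (F.LdivX κ) (P k) * F.LdivX κ *
          (F.L κ - PowerSeries.C (PowerSeries.coeff 1 (F.T κ)) * PowerSeries.X) := by
  open PathLengths PathLengths.TreeFamily in
  refine ⟨pathPoly, pathPolyRest, rfl, fun k hk => pathPoly_eq hk,
    fun k hk => pathPolyRest_of_lt_two hk, fun k hk => natDegree_pathPolyRest hk,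
    fun F κ h k => ⟨?_, ?_, ?_, ?_⟩⟩
  · rw [rootPaths_eq, h.rootSum_lengthPow isLocal_one, rootSum_one_lengthPow_zero]
  · rw [rootLeafPaths_eq, h.rootSum_lengthPow isLocal_leafWeight,
      rootSum_leafWeight_lengthPow_zero]
  · rw [verticalPaths_eq, h.verticalSum_eq isLocal_one, h.rootSum_lengthPow isLocal_one,
      rootSum_one_lengthPow_zero, mul_left_comm, mul_assoc]
  · rw [verticalLeafPaths_eq, h.verticalSum_eq isLocal_leafWeight,
      h.rootSum_lengthPow isLocal_leafWeight, rootSum_leafWeight_lengthPow_zero, mul_left_comm,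
      mul_assoc]
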